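/- Consider the Kolmogorov flow $V(x,y,z)=\langle \sin z,\sin x,\sin y\rangle$ on $\mathbb{R}^3$; an orbit is a curve $X:\mathbb{R}\to\mathbb{R}^3$ with $\dot X(t)=V(X(t))$ for all $t\in\mathbb{R}$. Let $e_1=\langle 1,0,0\rangle$. There are real numbers $a_2, b_2, \tau_2$ with $$0.029<a_2<0.030,\qquad 0.602<b_2<0.603,\qquad |\tau_2-15.160|<0.0005,$$ and an orbit $X_2$ such that $$X_2(0)=\langle 0,a_2,\pi/2\rangle,\qquad X_2(\tau_2/4)=\langle \pi/2,\pi,\pi+b_2\rangle,$$ and $X_2$ is a ballistic orbit in the $x$-direction with period $\tau_2$: $X_2(t+\tau_2)=X_2(t)+2\pi e_1$ for all $t\in\mathbb{R}$, and $X_2(t)\cdot e_1/t\to 2\pi/\tau_2$ as $t\to\infty$. Moreover, the orbit $X_{-2}$ with $X_{-2}(0)=\langle 0,-a_2,-\pi/2\rangle$ is the point reflection $X_{-2}(t)=-X_2(t)$, and it is a ballistic orbit in the negative $x$-direction with the same period: $X_{-2}(t+\tau_2)=X_{-2}(t)-2\pi e_1$ for all $t\in\mathbb{R}$, and $X_{-2}(t)\cdot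 e_1/t\to-2\pi/\tau_2$ as $t\to\infty$. -/

import Mathlib

/-- Three dimensional Euclidean space, with coordinates `x = p 0`, `y = p 1`, `z = p 2`. -/
abbrev Space3 : Type := EuclideanSpace ℝ (Fin 3)

/-- The unit vector in the `x`-direction. -/
noncomputable def e₁ : Space3 := !₂[1, 0, 0]

/-- The Kolmogorov flow `V(x, y, z) = (sin z, sin x, sin y)`. -/
noncomputable def kolmogorovFlow (p : Space3) : Space3 :=
  !₂[Real.sin (p 2), Real.sin (p 0), Real.sin (p 1)]

/-- A Lagrangian trajectory of the velocity field `V`, defined for all times. -/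
def IsOrbit (V : Space3 → Space3) (X : ℝ → Space3) : Prop :=
  ∀ t : ℝ, HasDerivAt X (V (X t)) t

/-- `X` is an orbit of `V` that is ballistic in the direction of the unit vector `e`, with period
`τ`: it is periodic modulo the translation by `2π e`, and so moves in the direction `e` with the
large time asymptotic speed `2π / τ`. -/
structure IsBallisticOrbit (V : Space3 → Space3) (e : Space3) (τ : ℝ) (X : ℝ → Space3) :
    Prop where
  orbit : IsOrbit V X
  period_pos : 0 < τ
  periodic : ∀ t : ℝ, X (t + τ) = X t + (2 * Real.pi) • e
  speed : Filter.Tendsto (fun t : ℝ => inner ℝ (X t) e / t) Filter.atTop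
    (nhds (2 * Real.pi / τ))

open Set Filter Topology
open scoped NNReal

/-- A bounded Lipschitz vector field on a Banach space has integral curves defined for all times. -/
theorem exists_global_integralCurve {E : Type*} [NormedAddCommGroup E] [NormedSpace ℝ E]
    [CompleteSpace E] {v : E → E} {K L : ℝ≥0} (hv : LipschitzWith K v) (hL : ∀ x, ‖v x‖ ≤ L)
    (x₀ : E) : ∃ f : ℝ → E, f 0 = x₀ ∧ ∀ t, HasDerivAt f (v (f t)) t := by
  have key : ∀ n : ℕ, ∃ f : ℝ → E, f 0 = x₀ ∧
      ∀ t ∈ Ioo (-(n + 1 : ℝ)) (n + 1), HasDerivAt f (v (f t)) t := by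
    intro n
    have h0 : (0 : ℝ) ∈ Icc (-(n + 1 : ℝ)) (n + 1) := by
      constructor <;> linarith [n.cast_nonneg (α := ℝ)]
    have hPL : IsPicardLindelof (fun _ : ℝ => v) (⟨0, h0⟩ : Icc (-(n + 1 : ℝ)) (n + 1)) x₀
        (L * (n + 1)) 0 L K :=
      IsPicardLindelof.of_time_independent (fun x _ => hL x) hv.lipschitzOnWith (by simp)
    obtain ⟨f, hf0, hf⟩ := hPL.exists_eq_forall_mem_Icc_hasDerivWithinAt₀
    exact ⟨f, hf0, fun t ht => (hf t (Ioo_subset_Icc_self ht)).hasDerivAt (Icc_mem_nhds ht.1 ht.2)⟩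
  choose f hf0 hf using key
  have agree : ∀ m n : ℕ, m ≤ n → ∀ t ∈ Ioo (-(m + 1 : ℝ)) (m + 1), f m t = f n t := by
    intro m n hmn
    have hmn' : (m : ℝ) ≤ n := by exact_mod_cast hmn
    refine ODE_solution_unique_of_mem_Ioo (v := fun _ => v) (s := fun _ => univ) (t₀ := 0) (K := K)
      (fun _ _ => hv.lipschitzOnWith) ?_ (fun t ht => ⟨hf m t ht, trivial⟩)
      (fun t ht => ⟨hf n t ⟨?_, ?_⟩, trivial⟩) ?_
    · constructor <;> linarith [m.cast_nonneg (α := ℝ)]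
    · linarith [ht.1]
    · linarith [ht.2]
    · rw [hf0, hf0]
  have mem : ∀ t : ℝ, t ∈ Ioo (-((⌈|t|⌉₊ : ℝ) + 1)) ((⌈|t|⌉₊ : ℝ) + 1) := fun t =>
    abs_lt.mp (lt_of_le_of_lt (Nat.le_ceil _) (lt_add_one _))
  have eq : ∀ (n : ℕ) (t : ℝ), t ∈ Ioo (-(n + 1 : ℝ)) (n + 1) → f ⌈|t|⌉₊ t = f n t := by
    intro n t ht
    rcases le_total ⌈|t|⌉₊ n with h | h
    · exact agree _ _ h t (mem t)
    · exact (agree _ _ h t ht).symm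
  refine ⟨fun t => f ⌈|t|⌉₊ t, by simpa using hf0 _, fun t => ?_⟩
  refine (hf _ t (mem t)).congr_of_eventuallyEq ?_
  filter_upwards [Ioo_mem_nhds (mem t).1 (mem t).2] with s hs using eq _ s hs

/-- The Kolmogorov flow on `ℝ × ℝ × ℝ` in the coordinates `(x, y, z - π / 2)`. -/
noncomputable def shiftedFlow (p : ℝ × ℝ × ℝ) : ℝ × ℝ × ℝ :=
  (Real.cos p.2.2, Real.sin p.1, Real.sin p.2.1)

theorem lipschitzWith_shiftedFlow : LipschitzWith 1 shiftedFlow := by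
  refine LipschitzWith.of_dist_le_mul fun p q => ?_
  simp only [shiftedFlow, Prod.dist_eq, NNReal.coe_one, one_mul]
  have h1 : dist (Real.cos p.2.2) (Real.cos q.2.2) ≤ dist p.2.2 q.2.2 :=
    Real.abs_cos_sub_cos_le _ _
  have h2 : dist (Real.sin p.1) (Real.sin q.1) ≤ dist p.1 q.1 := Real.abs_sin_sub_sin_le _ _
  have h3 : dist (Real.sin p.2.1) (Real.sin q.2.1) ≤ dist p.2.1 q.2.1 :=
    Real.abs_sin_sub_sin_le _ _
  grind

theorem norm_shiftedFlow_le (p : ℝ × ℝ × ℝ) : ‖shiftedFlow p‖ ≤ 1 := by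
  simp only [shiftedFlow, Prod.norm_def, Real.norm_eq_abs, max_le_iff]
  exact ⟨Real.abs_cos_le_one _, Real.abs_sin_le_one _, Real.abs_sin_le_one _⟩

/-- An integral curve of the shifted Kolmogorov flow, defined for all times. -/
def IsShiftedOrbit (f : ℝ → ℝ × ℝ × ℝ) : Prop := ∀ t, HasDerivAt f (shiftedFlow (f t)) t

theorem exists_isShiftedOrbit (p : ℝ × ℝ × ℝ) : ∃ f, f 0 = p ∧ IsShiftedOrbit f :=
  exists_global_integralCurve lipschitzWith_shiftedFlow (L := 1) norm_shiftedFlow_le p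

namespace IsShiftedOrbit

variable {f g : ℝ → ℝ × ℝ × ℝ}

theorem continuous (hf : IsShiftedOrbit f) : Continuous f :=
  continuous_iff_continuousAt.mpr fun t => (hf t).continuousAt

theorem ext (hf : IsShiftedOrbit f) (hg : IsShiftedOrbit g) {t₀ : ℝ} (h : f t₀ = g t₀) : f = g :=
  ODE_solution_unique_univ (v := fun _ => shiftedFlow) (s := fun _ => univ)
    (fun _ => lipschitzWith_shiftedFlow.lipschitzOnWith) (fun t => ⟨hf t, trivial⟩)
    (fun t => ⟨hg t, trivial⟩) h

theorem dist_le (hf : IsShiftedOrbit f) (hg : IsShiftedOrbit g) {t : ℝ} (ht : 0 ≤ t) :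
    dist (f t) (g t) ≤ dist (f 0) (g 0) * Real.exp t := by
  have := dist_le_of_trajectories_ODE (v := fun _ => shiftedFlow) (K := 1) (a := 0) (b := t)
    (fun _ => lipschitzWith_shiftedFlow) hf.continuous.continuousOn
    (fun s _ => (hf s).hasDerivWithinAt) hg.continuous.continuousOn
    (fun s _ => (hg s).hasDerivWithinAt) le_rfl t ⟨ht, le_rfl⟩
  simpa using this

theorem dist_time_le (hf : IsShiftedOrbit f) (s t : ℝ) : dist (f s) (f t) ≤ |s - t| := by
  have := Convex.norm_image_sub_le_of_norm_hasDerivWithin_le (f := f) (s := univ) (C := 1)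
    (fun x _ => (hf x).hasDerivWithinAt) (fun x _ => norm_shiftedFlow_le _) convex_univ
    (mem_univ t) (mem_univ s)
  simpa [dist_eq_norm] using this

theorem hasDerivAt_x (hf : IsShiftedOrbit f) (t : ℝ) :
    HasDerivAt (fun s => (f s).1) (Real.cos (f t).2.2) t := (hf t).fst

theorem hasDerivAt_y (hf : IsShiftedOrbit f) (t : ℝ) :
    HasDerivAt (fun s => (f s).2.1) (Real.sin (f t).1) t := (hf t).snd.fst

theorem hasDerivAt_w (hf : IsShiftedOrbit f) (t : ℝ) :
    HasDerivAt (fun s => (f s).2.2) (Real.sin (f t).2.1) t := (hf t).snd.snd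

/-- Reversing symmetry: an orbit through the axis `x = w = 0` at time `0`. -/
theorem neg_time (hf : IsShiftedOrbit f) (hx : (f 0).1 = 0) (hw : (f 0).2.2 = 0) (t : ℝ) :
    f (-t) = (-(f t).1, (f t).2.1, -(f t).2.2) := by
  have hg : IsShiftedOrbit fun t => (-(f (-t)).1, (f (-t)).2.1, -(f (-t)).2.2) := by
    intro t
    have hneg : HasDerivAt (fun s : ℝ => -s) (-1) t := hasDerivAt_neg t
    have h := ((((hf.hasDerivAt_x (-t)).comp t hneg).neg).prodMk
      (((hf.hasDerivAt_y (-t)).comp t hneg).prodMk (((hf.hasDerivAt_w (-t)).comp t hneg).neg)))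
    exact h.congr_deriv (by simp [shiftedFlow])
  have h := hf.ext hg (t₀ := 0) (by ext <;> simp [hx, hw])
  have h' := congrFun h t
  have e1 : (f t).1 = -(f (-t)).1 := congrArg Prod.fst h'
  have e2 : (f t).2.1 = (f (-t)).2.1 := congrArg (fun p => p.2.1) h'
  have e3 : (f t).2.2 = -(f (-t)).2.2 := congrArg (fun p => p.2.2) h'
  ext <;> simp [e1, e2, e3]

/-- Reversing symmetry: an orbit through the line `x = π / 2`, `y = π` at time `T`. -/
theorem reflect_time (hf : IsShiftedOrbit f) {T : ℝ} (hx : (f T).1 = Real.pi / 2)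
    (hy : (f T).2.1 = Real.pi) (t : ℝ) :
    f (2 * T - t) = (Real.pi - (f t).1, 2 * Real.pi - (f t).2.1, (f t).2.2) := by
  have hg : IsShiftedOrbit fun t => (Real.pi - (f (2 * T - t)).1,
      2 * Real.pi - (f (2 * T - t)).2.1, (f (2 * T - t)).2.2) := by
    intro t
    have hneg : HasDerivAt (fun s : ℝ => 2 * T - s) (-1) t := by
      simpa using (hasDerivAt_id t).const_sub (2 * T)
    have h := ((((hf.hasDerivAt_x (2 * T - t)).comp t hneg).const_sub Real.pi).prodMk
      ((((hf.hasDerivAt_y (2 * T - t)).comp t hneg).const_sub (2 * Real.pi)).prodMk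
        ((hf.hasDerivAt_w (2 * T - t)).comp t hneg)))
    exact h.congr_deriv (by simp [shiftedFlow, Real.sin_pi_sub, Real.sin_two_pi_sub])
  have h := hf.ext hg (t₀ := T) (by
    have : 2 * T - T = T := by ring
    ext
    · simp only [this, hx]; ring
    · simp only [this, hy]; ring
    · simp only [this])
  have h' := congrFun h t
  have e1 : (f t).1 = Real.pi - (f (2 * T - t)).1 := congrArg Prod.fst h'
  have e2 : (f t).2.1 = 2 * Real.pi - (f (2 * T - t)).2.1 := congrArg (fun p => p.2.1) h'
  have e3 : (f t).2.2 = (f (2 * T - t)).2.2 := congrArg (fun p => p.2.2) h'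
  ext <;> simp [e1, e2, e3]

theorem periodic (hf : IsShiftedOrbit f) (hx0 : (f 0).1 = 0) (hw0 : (f 0).2.2 = 0) {T : ℝ}
    (hx : (f T).1 = Real.pi / 2) (hy : (f T).2.1 = Real.pi) (t : ℝ) :
    f (t + 4 * T) = ((f t).1 + 2 * Real.pi, (f t).2.1, (f t).2.2) := by
  have half : ∀ t, f (t + 2 * T) = (Real.pi + (f t).1, 2 * Real.pi - (f t).2.1, -(f t).2.2) := by
    intro t
    have h := hf.reflect_time hx hy (-t)
    rw [hf.neg_time hx0 hw0 t] at h
    rw [show t + 2 * T = 2 * T - -t by ring, h]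
    ext <;> simp
  rw [show t + 4 * T = t + 2 * T + 2 * T by ring, half, half]
  ext
  · simp only; ring
  · simp only; ring
  · simp only; ring

/-- The corresponding orbit of the Kolmogorov flow. -/
theorem isOrbit (hf : IsShiftedOrbit f) : IsOrbit kolmogorovFlow
    fun t => !₂[(f t).1, (f t).2.1, (f t).2.2 + Real.pi / 2] := by
  intro t
  have h : HasDerivAt (fun s => ![(f s).1, (f s).2.1, (f s).2.2 + Real.pi / 2])
      ![Real.cos (f t).2.2, Real.sin (f t).1, Real.sin (f t).2.1] t := by
    rw [hasDerivAt_pi]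
    intro i
    fin_cases i
    · exact hf.hasDerivAt_x t
    · exact hf.hasDerivAt_y t
    · exact (hf.hasDerivAt_w t).add_const _
  refine ((EuclideanSpace.equiv (Fin 3) ℝ).symm.toContinuousLinearMap.hasFDerivAt.comp_hasDerivAt
    t h).congr_deriv ?_
  ext i
  fin_cases i <;> simp [kolmogorovFlow, Real.sin_add_pi_div_two]

end IsShiftedOrbit

/-- How far `c + i s` is from the point of the unit circle at angle `p`. -/
noncomputable def phaseDist (p s c : ℝ) : ℝ :=
  ‖((c : ℂ) + s * Complex.I) - Complex.exp (p * Complex.I)‖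

theorem abs_sin_sub_le_phaseDist (p s c : ℝ) : |s - Real.sin p| ≤ phaseDist p s c := by
  refine le_of_eq_of_le ?_ (Complex.abs_im_le_norm _)
  simp [Complex.exp_ofReal_mul_I_im]

theorem abs_cos_sub_le_phaseDist (p s c : ℝ) : |c - Real.cos p| ≤ phaseDist p s c := by
  refine le_of_eq_of_le ?_ (Complex.abs_re_le_norm _)
  simp [Complex.exp_ofReal_mul_I_re]

theorem phaseDist_eq (p s c : ℝ) :
    phaseDist p s c = ‖((c : ℂ) + s * Complex.I) * Complex.exp (-(p * Complex.I)) - 1‖ := by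
  have h : ((c : ℂ) + s * Complex.I) * Complex.exp (-(p * Complex.I)) - 1
      = (((c : ℂ) + s * Complex.I) - Complex.exp (p * Complex.I))
        * Complex.exp (((-p : ℝ) : ℂ) * Complex.I) := by
    rw [sub_mul, ← Complex.exp_add]
    simp
  rw [h, norm_mul, Complex.norm_exp_ofReal_mul_I, mul_one, phaseDist]

/-- If `(s, c)` almost solves the equations of `(sin ∘ p, cos ∘ p)`, then it stays close to it: the
error does not get amplified. -/
theorem phaseDist_le_of_deriv {p s c p' s' c' : ℝ → ℝ} {δ : ℝ}
    (hp : ∀ θ, HasDerivAt p (p' θ) θ) (hs : ∀ θ, HasDerivAt s (s' θ) θ)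
    (hc : ∀ θ, HasDerivAt c (c' θ) θ)
    (h1 : ∀ θ ∈ Icc (-1 : ℝ) 1, |s' θ - c θ * p' θ| ≤ δ)
    (h2 : ∀ θ ∈ Icc (-1 : ℝ) 1, |c' θ + s θ * p' θ| ≤ δ) {θ : ℝ} (hθ : θ ∈ Icc (-1 : ℝ) 1) :
    phaseDist (p θ) (s θ) (c θ) ≤ phaseDist (p (-1)) (s (-1)) (c (-1)) + 4 * δ := by
  set u : ℝ → ℂ := fun θ => ((c θ : ℂ) + s θ * Complex.I) * Complex.exp (-(p θ * Complex.I))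
  have hu : ∀ θ, HasDerivAt u ((((c' θ + s θ * p' θ : ℝ) : ℂ) + ((s' θ - c θ * p' θ : ℝ) : ℂ)
      * Complex.I) * Complex.exp (((-p θ : ℝ) : ℂ) * Complex.I)) θ := by
    intro θ
    have h := ((hc θ).ofReal_comp.add ((hs θ).ofReal_comp.mul_const Complex.I)).mul
      (((hp θ).ofReal_comp.mul_const Complex.I).neg.cexp)
    refine h.congr_deriv ?_
    simp only [Pi.neg_apply, Pi.add_apply]
    push_cast
    rw [neg_mul]
    linear_combination (-(s θ : ℂ) * p' θ * Complex.exp (-(p θ * Complex.I))) * Complex.I_mul_I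
  have hb : ∀ θ ∈ Icc (-1 : ℝ) 1, ‖(((c' θ + s θ * p' θ : ℝ) : ℂ) +
      ((s' θ - c θ * p' θ : ℝ) : ℂ) * Complex.I) * Complex.exp (((-p θ : ℝ) : ℂ) * Complex.I)‖
      ≤ 2 * δ := by
    intro θ hθ
    rw [norm_mul, Complex.norm_exp_ofReal_mul_I, mul_one]
    refine (norm_add_le _ _).trans ?_
    rw [norm_mul, Complex.norm_I, mul_one, Complex.norm_real, Complex.norm_real,
      Real.norm_eq_abs, Real.norm_eq_abs]
    linarith [h1 θ hθ, h2 θ hθ]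
  have hm := Convex.norm_image_sub_le_of_norm_hasDerivWithin_le (f := u) (s := Icc (-1 : ℝ) 1)
    (fun x _ => (hu x).hasDerivWithinAt) hb (convex_Icc _ _)
    (left_mem_Icc.mpr (by norm_num)) hθ
  have hδ : 0 ≤ δ := (abs_nonneg _).trans (h1 θ hθ)
  have hθ' : ‖θ - -1‖ ≤ 2 := by
    rw [Real.norm_eq_abs, abs_le]
    constructor <;> linarith [hθ.1, hθ.2]
  rw [phaseDist_eq, phaseDist_eq]
  calc ‖u θ - 1‖ = ‖(u (-1) - 1) + (u θ - u (-1))‖ := by congr 1; ring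
    _ ≤ ‖u (-1) - 1‖ + ‖u θ - u (-1)‖ := norm_add_le _ _
    _ ≤ ‖u (-1) - 1‖ + 2 * δ * 2 := by
        gcongr
        exact hm.trans (by gcongr)
    _ = _ := by simp only [u]; ring

/-- Propagation of the distance between an orbit and an approximate orbit over a time `2 h`. The
approximate orbit is parametrized by `[-1, 1]`. -/
theorem IsShiftedOrbit.dist_le_of_approx {f : ℝ → ℝ × ℝ × ℝ} (hf : IsShiftedOrbit f)
    {P P' : ℝ → ℝ × ℝ × ℝ} {h η t₀ : ℝ} (hh : 0 < h) (hP : ∀ θ, HasDerivAt P (P' θ) θ)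
    (hb : ∀ θ ∈ Icc (-1 : ℝ) 1, dist (P' θ) (h • shiftedFlow (P θ)) ≤ h * η)
    (h0 : dist (P (-1)) (f t₀) ≤ η * (Real.exp t₀ - 1)) :
    dist (P 1) (f (t₀ + 2 * h)) ≤ η * (Real.exp (t₀ + 2 * h) - 1) := by
  set T : ℝ → ℝ := fun t => h⁻¹ * (t - t₀) - 1
  have hT : ∀ t, HasDerivAt T h⁻¹ t := fun t => by
    exact ((((hasDerivAt_id t).sub_const t₀).const_mul h⁻¹).sub_const 1).congr_deriv (mul_one _)
  have hQ : ∀ t, HasDerivAt (fun t => P (T t)) (h⁻¹ • P' (T t)) t := fun t =>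
    (hP (T t)).scomp t (hT t)
  have hmem : ∀ t ∈ Ico t₀ (t₀ + 2 * h), T t ∈ Icc (-1 : ℝ) 1 := by
    intro t ht
    have h1 : 0 ≤ h⁻¹ * (t - t₀) := mul_nonneg (by positivity) (by linarith [ht.1])
    have h2 : h⁻¹ * (t - t₀) ≤ 2 := by
      rw [inv_mul_le_iff₀ hh]
      linarith [ht.2]
    constructor <;> simp only [T] <;> linarith
  have hd : ∀ t ∈ Ico t₀ (t₀ + 2 * h), dist (h⁻¹ • P' (T t)) (shiftedFlow (P (T t))) ≤ η := by
    intro t ht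
    have h1 := hb _ (hmem t ht)
    have h2 : h⁻¹ • P' (T t) - shiftedFlow (P (T t))
        = h⁻¹ • (P' (T t) - h • shiftedFlow (P (T t))) := by
      rw [smul_sub, smul_smul, inv_mul_cancel₀ hh.ne', one_smul]
    rw [dist_eq_norm] at h1 ⊢
    rw [h2, norm_smul, norm_inv, Real.norm_eq_abs, abs_of_pos hh, inv_mul_le_iff₀ hh]
    exact h1
  have hT0 : T t₀ = -1 := by simp [T]
  have hT1 : T (t₀ + 2 * h) = 1 := by
    simp only [T]; field_simp; ring
  have key := dist_le_of_approx_trajectories_ODE (v := fun _ => shiftedFlow) (K := 1) (a := t₀)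
    (b := t₀ + 2 * h) (f := fun t => P (T t)) (g := f) (εf := η) (εg := 0)
    (δ := η * (Real.exp t₀ - 1))
    (fun _ => lipschitzWith_shiftedFlow) (fun t _ => (hQ t).continuousAt.continuousWithinAt)
    (fun t _ => (hQ t).hasDerivWithinAt) hd hf.continuous.continuousOn
    (fun t _ => (hf t).hasDerivWithinAt) (fun t _ => by simp) (by simpa [hT0] using h0)
    (t₀ + 2 * h) ⟨by linarith, le_rfl⟩
  simp only [hT1] at key
  refine key.trans_eq ?_
  rw [gronwallBound_of_K_ne_0 (by norm_num)]
  simp only [NNReal.coe_one, one_mul, div_one, add_zero, add_sub_cancel_left]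
  rw [Real.exp_add]
  ring

/-! ### Polynomials with integer coefficients, as lists -/

namespace IntPoly

/-- The value of the polynomial with coefficient list `l`, constant term first. -/
noncomputable def eval (θ : ℝ) : List ℤ → ℝ
  | [] => 0
  | a :: l => a + θ * eval θ l

/-- The value at an integer. -/
def evalInt (k : ℤ) : List ℤ → ℤ
  | [] => 0
  | a :: l => a + k * evalInt k l

/-- Sum. -/
def add : List ℤ → List ℤ → List ℤ
  | [], m => m
  | l, [] => l
  | a :: l, b :: m => (a + b) :: add l m

/-- Multiplication by an integer. -/
def smul (k : ℤ) : List ℤ → List ℤ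
  | [] => []
  | a :: l => k * a :: smul k l

/-- Product. -/
def mul : List ℤ → List ℤ → List ℤ
  | [], _ => []
  | a :: l, m => add (smul a m) (0 :: mul l m)

/-- Derivative. -/
def deriv : List ℤ → List ℤ
  | [] => []
  | _ :: l => add l (0 :: deriv l)

/-- Sum of the absolute values of the coefficients. -/
def norm : List ℤ → ℕ
  | [] => 0
  | a :: l => a.natAbs + norm l

theorem eval_intCast (k : ℤ) (l : List ℤ) : eval k l = evalInt k l := by
  induction l with
  | nil => simp [eval, evalInt]
  | cons a l ih => simp [eval, evalInt, ih]

theorem eval_add (θ : ℝ) (l m : List ℤ) : eval θ (add l m) = eval θ l + eval θ m := by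
  induction l generalizing m with
  | nil => simp [add, eval]
  | cons a l ih =>
    cases m with
    | nil => simp [add, eval]
    | cons b m => simp only [add, eval, ih]; push_cast; ring

theorem eval_smul (θ : ℝ) (k : ℤ) (l : List ℤ) : eval θ (smul k l) = k * eval θ l := by
  induction l with
  | nil => simp [smul, eval]
  | cons a l ih => simp only [smul, eval, ih]; push_cast; ring

theorem eval_mul (θ : ℝ) (l m : List ℤ) : eval θ (mul l m) = eval θ l * eval θ m := by
  induction l with
  | nil => simp [mul, eval]
  | cons a l ih => simp only [mul, eval, eval_add, eval_smul, ih]; push_cast; ring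

theorem hasDerivAt_eval (l : List ℤ) (θ : ℝ) :
    HasDerivAt (fun θ => eval θ l) (eval θ (deriv l)) θ := by
  induction l with
  | nil => simpa [eval, deriv] using hasDerivAt_const θ (0 : ℝ)
  | cons a l ih =>
    refine (((hasDerivAt_id θ).mul ih).const_add (a : ℝ)).congr_deriv ?_
    simp [deriv, eval_add, eval]

theorem abs_eval_le {θ : ℝ} (hθ : θ ∈ Icc (-1 : ℝ) 1) (l : List ℤ) : |eval θ l| ≤ norm l := by
  induction l with
  | nil => simp [eval, norm]
  | cons a l ih =>
    simp only [eval, norm]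
    push_cast
    refine (abs_add_le _ _).trans (add_le_add (by simp) ?_)
    rw [abs_mul]
    exact (mul_le_of_le_one_left (abs_nonneg _) (abs_le.mpr hθ)).trans ih

end IntPoly

open IntPoly

/-- The common denominator of the coefficients. -/
def scale : ℤ := 1000000000000

theorem scale_pos : (0 : ℝ) < scale := by norm_num [scale]

/-- `s' - c p'` and `c' + s p'`, scaled to integers, have norm at most `δ`. -/
def phaseOk (δ : ℕ) (p s c : List ℤ) : Bool :=
  decide (norm (add (smul scale (deriv s)) (smul (-1) (mul c (deriv p)))) ≤ δ) &&
  decide (norm (add (smul scale (deriv c)) (mul s (deriv p))) ≤ δ)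

/-- `p' - h v`, scaled to integers, has norm at most `ε`. -/
def posOk (H : ℤ) (ε : ℕ) (p v : List ℤ) : Bool :=
  decide (norm (add (smul scale (deriv p)) (smul (-H) v)) ≤ ε)

theorem phaseDist_le_of_phaseOk {δ : ℕ} {p s c : List ℤ} (h : phaseOk δ p s c = true) {θ : ℝ}
    (hθ : θ ∈ Icc (-1 : ℝ) 1) :
    phaseDist (eval θ p / scale) (eval θ s / scale) (eval θ c / scale) ≤
      phaseDist (evalInt (-1) p / scale) (evalInt (-1) s / scale) (evalInt (-1) c / scale)
        + 4 * (δ / scale ^ 2) := by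
  have hS := scale_pos
  simp only [phaseOk, Bool.and_eq_true, decide_eq_true_eq] at h
  have e : ∀ l, ((evalInt (-1) l : ℤ) : ℝ) = eval (-1) l := fun l => by
    rw [← eval_intCast]; norm_num
  rw [e, e, e]
  refine phaseDist_le_of_deriv (p := fun θ => eval θ p / scale) (s := fun θ => eval θ s / scale)
    (c := fun θ => eval θ c / scale) (fun θ => (hasDerivAt_eval p θ).div_const _)
    (fun θ => (hasDerivAt_eval s θ).div_const _) (fun θ => (hasDerivAt_eval c θ).div_const _)
    (fun θ hθ => ?_) (fun θ hθ => ?_) hθ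
  · have h1 := (abs_eval_le hθ _).trans (Nat.cast_le.mpr h.1)
    rw [eval_add, eval_smul, eval_smul, eval_mul] at h1
    rw [le_div_iff₀ (by positivity), ← abs_of_pos (pow_pos hS 2), ← abs_mul]
    refine (le_of_eq (congrArg abs ?_)).trans h1
    push_cast
    field_simp
    ring
  · have h1 := (abs_eval_le hθ _).trans (Nat.cast_le.mpr h.2)
    rw [eval_add, eval_smul, eval_mul] at h1
    rw [le_div_iff₀ (by positivity), ← abs_of_pos (pow_pos hS 2), ← abs_mul]
    refine (le_of_eq (congrArg abs ?_)).trans h1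
    field_simp

theorem abs_deriv_sub_le_of_posOk {H : ℤ} {ε : ℕ} {p v : List ℤ} (h : posOk H ε p v = true)
    {θ : ℝ} (hθ : θ ∈ Icc (-1 : ℝ) 1) :
    |eval θ (deriv p) / scale - (H / scale) * (eval θ v / scale)| ≤ ε / scale ^ 2 := by
  have hS := scale_pos
  simp only [posOk, decide_eq_true_eq] at h
  have h1 := (abs_eval_le hθ _).trans (Nat.cast_le.mpr h)
  rw [eval_add, eval_smul, eval_smul] at h1
  rw [le_div_iff₀ (by positivity), ← abs_of_pos (pow_pos hS 2), ← abs_mul]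
  refine (le_of_eq (congrArg abs ?_)).trans h1
  push_cast
  field_simp
  ring

/-- Polynomial approximations to `x`, `y`, `w` and to the sines and cosines of these. -/
structure Piece where
  px : List ℤ
  py : List ℤ
  pw : List ℤ
  sx : List ℤ
  cx : List ℤ
  sy : List ℤ
  cy : List ℤ
  sw : List ℤ
  cw : List ℤ

namespace Piece

/-- The values of the nine polynomials at an integer. -/
def values (A : Piece) (k : ℤ) : List ℤ :=
  [A.px, A.py, A.pw, A.sx, A.cx, A.sy, A.cy, A.sw, A.cw].map (evalInt k)

/-- The check that the polynomials almost solve the differential equations. -/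
def ok (H : ℤ) (δ ε : ℕ) (A : Piece) : Bool :=
  phaseOk δ A.px A.sx A.cx && phaseOk δ A.py A.sy A.cy && phaseOk δ A.pw A.sw A.cw &&
  posOk H ε A.px A.cw && posOk H ε A.py A.sx && posOk H ε A.pw A.sy

end Piece

/-- The state `v` (positions, then sines and cosines) approximates the orbit `f` at time `t`. -/
def Near (f : ℝ → ℝ × ℝ × ℝ) (η t d : ℝ) : List ℤ → Prop
  | [x, y, w, sx, cx, sy, cy, sw, cw] =>
    dist ((x / scale, y / scale, w / scale) : ℝ × ℝ × ℝ) (f t) ≤ η * (Real.exp t - 1) ∧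
    phaseDist (x / scale) (sx / scale) (cx / scale) ≤ d ∧
    phaseDist (y / scale) (sy / scale) (cy / scale) ≤ d ∧
    phaseDist (w / scale) (sw / scale) (cw / scale) ≤ d
  | _ => False

theorem Near.step {f : ℝ → ℝ × ℝ × ℝ} (hf : IsShiftedOrbit f) {H : ℤ} (hH : 0 < H) {δ ε : ℕ}
    {η t d : ℝ} {A : Piece} (hA : A.ok H δ ε = true) (hn : Near f η t d (A.values (-1)))
    (hη : d + 4 * (δ / scale ^ 2) + ε / (scale * H) ≤ η) :
    Near f η (t + 2 * (H / scale)) (d + 4 * (δ / scale ^ 2)) (A.values 1) := by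
  have hS := scale_pos
  have hH' : (0 : ℝ) < H := by exact_mod_cast hH
  simp only [Piece.ok, Bool.and_eq_true] at hA
  obtain ⟨⟨⟨⟨⟨kx, ky⟩, kw⟩, qx⟩, qy⟩, qw⟩ := hA
  simp only [Piece.values, List.map_cons, List.map_nil, Near] at hn ⊢
  obtain ⟨n0, nx, ny, nw⟩ := hn
  have ephase : ∀ {p s c : List ℤ}, phaseOk δ p s c = true →
      phaseDist (evalInt (-1) p / scale) (evalInt (-1) s / scale) (evalInt (-1) c / scale) ≤ d →
      ∀ θ ∈ Icc (-1 : ℝ) 1, phaseDist (eval θ p / scale) (eval θ s / scale) (eval θ c / scale) ≤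
        d + 4 * (δ / scale ^ 2) := fun hk h0 θ hθ =>
    (phaseDist_le_of_phaseOk hk hθ).trans (by linarith)
  have e1 : ∀ l, ((evalInt 1 l : ℤ) : ℝ) = eval 1 l := fun l => by
    rw [← eval_intCast]; norm_num
  have em1 : ∀ l, ((evalInt (-1) l : ℤ) : ℝ) = eval (-1) l := fun l => by
    rw [← eval_intCast]; norm_num
  have m1 : (1 : ℝ) ∈ Icc (-1 : ℝ) 1 := by constructor <;> norm_num
  have bound : ∀ {p v : List ℤ} {q : ℝ} {θ : ℝ}, posOk H ε p v = true → θ ∈ Icc (-1 : ℝ) 1 →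
      |eval θ v / scale - q| ≤ d + 4 * (δ / scale ^ 2) →
      |eval θ (IntPoly.deriv p) / scale - H / scale * q| ≤ H / scale * η := by
    intro p v q θ hk hθ hq
    have h1 := abs_deriv_sub_le_of_posOk hk hθ
    have h2 : |(H : ℝ) / scale * (eval θ v / scale - q)| ≤
        H / scale * (d + 4 * (δ / scale ^ 2)) := by
      rw [abs_mul, abs_of_pos (div_pos hH' hS)]
      gcongr
    have h3 : (H : ℝ) / scale * (d + 4 * (δ / scale ^ 2)) + ε / scale ^ 2 ≤ H / scale * η := by
      refine le_trans (le_of_eq ?_) (mul_le_mul_of_nonneg_left hη (div_pos hH' hS).le)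
      field_simp
    calc |eval θ (IntPoly.deriv p) / scale - H / scale * q|
        = |(eval θ (IntPoly.deriv p) / scale - (H / scale) * (eval θ v / scale)) +
          (H : ℝ) / scale * (eval θ v / scale - q)| := by congr 1; ring
      _ ≤ _ := abs_add_le _ _
      _ ≤ _ := by linarith
  refine ⟨?_, ?_, ?_, ?_⟩
  · have := hf.dist_le_of_approx (h := H / scale) (η := η) (t₀ := t)
      (P := fun θ => (eval θ A.px / scale, eval θ A.py / scale, eval θ A.pw / scale))
      (div_pos hH' hS)
      (fun θ => ((hasDerivAt_eval A.px θ).div_const _).prodMk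
        (((hasDerivAt_eval A.py θ).div_const _).prodMk ((hasDerivAt_eval A.pw θ).div_const _)))
      (fun θ hθ => ?_) (by simpa only [em1] using n0)
    · simpa only [e1] using this
    · simp only [Prod.dist_eq, shiftedFlow, Prod.smul_mk, Real.dist_eq, smul_eq_mul, max_le_iff]
      exact ⟨bound qx hθ ((abs_cos_sub_le_phaseDist _ _ _).trans (ephase kw nw θ hθ)),
        bound qy hθ ((abs_sin_sub_le_phaseDist _ _ _).trans (ephase kx nx θ hθ)),
        bound qw hθ ((abs_sin_sub_le_phaseDist _ _ _).trans (ephase ky ny θ hθ))⟩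
  · rw [e1, e1, e1]
    exact ephase kx nx 1 m1
  · rw [e1, e1, e1]
    exact ephase ky ny 1 m1
  · rw [e1, e1, e1]
    exact ephase kw nw 1 m1

/-- The pieces fit together, from the state `v` to the state `v'`, and each passes its check. -/
def chainOk (H : ℤ) (δ ε : ℕ) : List ℤ → List Piece → List ℤ → Bool
  | v, [], v' => decide (v = v')
  | v, A :: L, v' => decide (v = A.values (-1)) && A.ok H δ ε && chainOk H δ ε (A.values 1) L v'

theorem Near.chain {f : ℝ → ℝ × ℝ × ℝ} (hf : IsShiftedOrbit f) {H : ℤ} (hH : 0 < H) {δ ε : ℕ}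
    {η : ℝ} (L : List Piece) {t d : ℝ} {v v' : List ℤ} (hL : chainOk H δ ε v L v' = true)
    (hn : Near f η t d v) (hη : d + L.length * (4 * (δ / scale ^ 2)) + ε / (scale * H) ≤ η) :
    Near f η (t + L.length * (2 * (H / scale))) (d + L.length * (4 * (δ / scale ^ 2))) v' := by
  induction L generalizing t d v with
  | nil =>
    simp only [chainOk, decide_eq_true_eq] at hL
    simpa [hL] using hn
  | cons A L ih =>
    simp only [chainOk, Bool.and_eq_true, decide_eq_true_eq] at hL
    obtain ⟨⟨h1, h2⟩, h3⟩ := hL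
    have hδ : (0 : ℝ) ≤ δ / scale ^ 2 := by positivity
    have hl : (0 : ℝ) ≤ L.length * (4 * (δ / scale ^ 2)) := by positivity
    simp only [List.length_cons, Nat.cast_add, Nat.cast_one] at hη ⊢
    have := ih h3 (Near.step hf hH h2 (h1 ▸ hn) (by linarith)) (by linarith)
    convert this using 1 <;> ring

/-- Piecewise approximation to the orbit that starts from `y = 29400700000 / scale`. -/
def lowerPieces : List Piece := [
  { px := [378983844201, 378924659621, -144899868, -158326798, -110852349, -49538244, -12516888,
      -903568, 372499, 60212, 2950, -962, -305, -19, 3, 1],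
    py := [100364900660, 140221689724, 66711193979, -3372602924, -810233378, 18698846, 2530484,
      28345, 165783, 44115, -809, -1551, -164, 3, 4, 1],
    pw := [20136917207, 37974618992, 26438395619, 8261025353, -450073893, -123755791, -13985664,
      15601, 711662, 52719, -9441, -1525, -142, 3, 5, 1],
    sx := [369976610121, 352036570860, -26695959792, -8551241940, 246685647, 40060275, 523526,
      3499372, 1047593, -21352, -45028, -5181, 93, 158, 36, 3, -1],
    cx := [929041069040, -140193261057, -66644059332, 3464503073, 890950384, 27820560, 13995809,
      2614979, -524539, -264161, -13748, 5207, 1111, 119, -10, -6, -1],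
    sy := [100196487669, 139516047874, 65390443424, -4750101454, -1632655698, -221408057,
      288150, 15021839, 1251886, -249103, -44262, -4495, 111, 194, 40, 3, -1],
    cy := [994967669756, -14049720805, -16465815313, -8923317944, -1580538753, 393421213,
      66363213, -1523578, -1298201, -323052, -7405, 7966, 1155, 98, -8, -7, -1],
    sw := [20135556329, 37966919985, 26418517018, 8230009479, -482394040, -147003324, -25374025,
      -3464736, 275370, 153961, 37891, 2479, -985, -321, -30, 7, 2],
    cw := [999797259135, -764640080, -1253241465, -1169941015, -653536249, -198155749,
      -16688530, 7862753, 1429833, 77830, -27908, -9645, -639, 114, 38, 7] },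
  { px := [1130837281713, 366643389782, -10399059759, -4574525382, -989864790, -21853906,
      36324975, 5200520, -834206, -266811, 6206, 10508, 794, -334, -66, 7, 3],
    py := [608532915009, 342908847458, 29591357541, -8242253323, -189236868, 153565401,
      21777026, -658918, -1042618, -122538, 29375, 8319, -273, -365, -31, 12, 3],
    pw := [256069438754, 216661645685, 53316500233, -1178777706, -1712830727, 8492872, 45672130,
      2247059, -1470819, -180564, 38036, 9460, -459, -400, -25, 13, 2],
    sx := [904769106781, 156154303567, -65241852745, -1997214985, 2025920758, 344753673,
      -12169950, -22007687, -2909851, 775064, 241436, -8647, -12527, -1130, 456, 111, -8, -6],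
    cx := [425902410677, -331727612279, -19217723585, 13194959216, 1275187406, -192506004,
      -91688180, -6081771, 4365426, 894848, -114265, -57633, -1575, 2537, 393, -72, -28, 0, 1],
    sy := [571664350724, 281352450657, -9330657345, -18077297664, 112042728, 723038771,
      41502245, -31046192, -4287776, 1003584, 274563, -14535, -13730, -911, 531, 103, -13, -6],
    cy := [820487580718, -196028763640, -65155446488, 227923405, 3535183336, 114951178,
      -166558018, -13556717, 5914795, 1121265, -141529, -64084, -673, 2816, 352, -91, -27, 1, 1],
    sw := [253280120824, 209596955367, 45633236371, -5705968327, -3139626250, -126273105,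
      106941258, 21909760, -2030438, -1322336, -57166, 58662, 9248, -1873, -646, 22, 33, 3, -1],
    cw := [967392981368, -54876087796, -36209820261, -10447080483, -288308970, 575063296,
      96051447, -17608508, -6335864, 163739, 304987, 25155, -11453, -2447, 270, 147, 3, -7, -1] },
  { px := [1772062488752, 244711640716, -53508300687, -7065553508, 894055610, 246503173,
      -27523701, -6612848, 1249854, 127873, -57595, 65, 2396, -194, -86, 15, 2, -1],
    py := [1349687053303, 371351067223, -9270438655, -2354944053, 1395722373, -4636066,
      -46481555, 755448, 1533780, -97476, -53510, 7640, 1815, -449, -53, 23, 1, -1],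
    pw := [868889942253, 369774621053, 15433273568, -8755604588, 91953746, 153924552, -35384878,
      -2346251, 1624764, -30255, -57372, 6145, 1777, -406, -44, 21, 0, -1],
    sx := [979814244758, -48920327155, -18640644384, 14730520884, -61161580, -735852839,
      13952812, 32375173, -2314726, -1411879, 221732, 57461, -15417, -1944, 900, 38, -47, 1, 2],
    cx := [-199910094231, -239771951431, 58413881987, 6698361815, -2535142400, 32714238,
      129088526, -10841044, -6887971, 885012, 311987, -60587, -11572, 3717, 312, -206, -1, 10,
      -1],
    sy := [975654772629, 81441754824, -69305303157, 970484245, 2030658879, -560180553,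
      -43334276, 34295664, -718464, -1513778, 178353, 56273, -13929, -1612, 818, 14, -41, 3, 2],
    cy := [219312025770, -362310441056, -6076993568, 11379812363, -1629242983, -331557673,
      152240259, 4368781, -7567740, 473866, 302518, -51812, -10154, 3433, 220, -186, 4, 9, -1],
    sw := [763612671559, 238754080182, -42240756218, -15452019087, 2354293013, 671174548,
      -113927107, -19180093, 6349116, 284115, -340735, 15668, 15751, -2090, -601, 154, 16, -9],
    cw := [645674599037, -282364586255, -55927643022, 9435905795, 3252007893, -435729685,
      -122136543, 26382045, 3036545, -1519643, 1874, 75873, -6668, -3180, 595, 105, -38, -2, 2] },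
  { px := [2010847121114, -12702181710, -63493104977, 4064945164, 1190216375, -143705385,
      -13259771, 3875738, -37911, -11919, 4318, -2581, 84, 80, -9],
    py := [2056080134691, 342894036068, 1025377984, 3407747761, -233220326, -173289642,
      18801895, 2615307, -479184, 17865, 82, -1479, 547, -4, -23, 2],
    pw := [1604317462996, 335242971027, -30309915781, -6629864259, 116896916, -29383245,
      14508128, 2763323, -569880, -22234, 4986, -1000, 359, 11, -16, 1],
    sx := [904730026746, 5410944220, 26974150016, -2461418514, -2286133999, 297654156, 48303633,
      -10114663, 424234, 2162, -42934, 17324, -129, -835, 91, 14, -4],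
    cx := [-425985420765, 11492045198, 57478483962, -3334429329, -244800963, -9247663,
      -51510559, 10467958, 1720572, -639642, 1575, 17338, -1805, 52, 31, -22, 3, 1],
    sy := [884542599871, -159946152637, -52478929093, 1233735662, -387640224, 229679225,
      51037434, -12029076, -527980, 131558, -29033, 11371, 384, -596, 52, 8, -2],
    cy := [-466459418399, -303304382144, 26515300407, 3093276047, 536230641, 256818774,
      -62983599, -8068223, 1827320, -41275, 17053, 5178, -3009, 109, 89, -13],
    sw := [999438219323, -11235620834, -55146523603, 10588134702, 2227275125, -437753048,
      -23989960, 6537495, -836477, 217815, 13221, -15661, 1383, 294, -60, 8, 0, -1],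
    cw := [-33514858785, -335054638003, 32176219711, 12561600720, -1895841903, -209916391,
      71583272, -800229, -283035, 113920, -74898, 2670, 2740, -328, -6, 6, -3] },
  { px := [1778066439665, -192182255310, -22743184720, 7738836638, -67950402, -34058656,
      20763091, -936408, -631287, 5190, 14697, 635, -372, -18, 9],
    py := [2765378446964, 370889480153, 7494571761, -1691792701, -579237896, 89862588, 13418477,
      -2126905, 3852, 33991, -5793, -1148, 213, 49, -8, -1],
    pw := [2102584273747, 139245941731, -65368338054, -4073021849, 801656723, 115825686,
      -8180416, -4137478, 149601, 102965, -1190, -2041, -21, 44, -1, -1],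
    sx := [978596341733, 39549034959, -13391445994, -6113304541, 1185517578, 212428878,
      -39283049, 81310, 807172, -152838, -33322, 6747, 1696, -285, -56, 11, 1],
    cx := [-205789212409, 188068851993, 26056708733, -7831415983, -609050854, 87612785,
      19643759, -3980707, -69022, 239811, -37011, -9123, 1848, 280, -56, -8, 2],
    sy := [367402087338, -344950287931, -32240151000, 8460723513, 1528037303, -129504748,
      -76417496, 3157786, 2445075, -31389, -59223, -653, 1503, -46, -39, 6, 1],
    cy := [-930062205563, -136265569180, 61215695176, 6330915576, -888560346, -364298909,
      19796875, 15052890, -436943, -399067, 290, 9449, -30, -242, 21, 6, -1],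
    sw := [861901825111, -70608161750, 24790768614, 10138771790, -2066978941, -279164220,
      44181363, 1980207, -700564, 45769, 34656, -3344, -1991, 158, 83, -4, -3],
    cw := [-507075185619, -120016331318, 61257039861, -717151799, -449320867, 328701992,
      -17295069, -13325265, 123241, 387771, 18444, -11773, -605, 332, 2, -9, 1] }]

theorem lower_phaseOk : phaseOk 77000000000000 [14700350000, 14700350000]
    [14699820548, 14698761654, -1588318, -529401, 29, 6]
    [999891951800, -216092507, -108038470, 7783, 1946, 0] = true := by
  decide +kernel

theorem lower_chainOk : chainOk 379001498713 77000000000000 50000000000000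
    [0, 29400700000, 0, 0, 1000000000000, 29396464518, 999567830552, 0, 1000000000000]
    lowerPieces
    [1570797042752, 3141592653596, 2173294269446, 1000000000000,
      -715962, 0, -999999999998, 823922596934, -566702350680] = true := by
  decide +kernel

/-- Piecewise approximation to the orbit that starts from `y = 29401800000 / scale`. -/
def upperPieces : List Piece := [
  { px := [378983631545, 378924444819, -144904018, -158329655, -110853311, -49538292, -12516818,
      -903560, 372498, 60212, 2950, -962, -305, -19, 3, 1],
    py := [100365922218, 140221536474, 66711124526, -3372595931, -810231835, 18698748, 2530487,
      28351, 165783, 44115, -809, -1551, -164, 3, 4, 1],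
    pw := [20137312195, 37974982991, 26438349228, 8261010153, -450073514, -123755545, -13985591,
      15603, 711659, 52718, -9441, -1525, -142, 3, 5, 1],
    sx := [369976412553, 352036401114, -26695919361, -8551230435, 246684497, 40060343, 523639,
      3499363, 1047584, -21352, -45027, -5181, 93, 158, 36, 3, -1],
    cx := [929041147717, -140193106723, -66643987855, 3464498038, 890949850, 27820866, 13995760,
      2614944, -524539, -264160, -13748, 5207, 1111, 119, -10, -6, -1],
    sy := [100197504083, 139515881042, 65390359653, -4750100113, -1632653365, -221407027,
      288184, 15021783, 1251881, -249103, -44262, -4495, 111, 194, 40, 3, -1],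
    cy := [994967567397, -14049847974, -16465853773, -8923294081, -1580534402, 393420196,
      66363011, -1523584, -1298197, -323051, -7405, 7966, 1155, 98, -8, -7, -1],
    sw := [20135951238, 37967283608, 26418469863, 8229993399, -482394276, -147003322, -25373983,
      -3464718, 275373, 153961, 37890, 2478, -985, -321, -30, 7, 2],
    cw := [999797251181, -764662406, -1253264785, -1169951814, -653537259, -198154751,
      -16688385, 7862737, 1429827, 77828, -27908, -9645, -639, 114, 38, 7] },
  { px := [1130836588177, 366643104822, -10399088944, -4574525593, -989862150, -21853493,
      36324870, 5200491, -834204, -266810, 6206, 10508, 794, -334, -66, 7, 3],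
    py := [608533430421, 342908543852, 29591361601, -8242236661, -189236202, 153565096,
      21776931, -658926, -1042614, -122536, 29375, 8319, -273, -365, -31, 12, 3],
    pw := [256070272538, 216661684864, 53316404082, -1178773350, -1712826664, 8492774, 45671947,
      2247049, -1470812, -180563, 38036, 9460, -459, -400, -25, 13, 2],
    sx := [904768811398, 156154412267, -65241757318, -1997209068, 2025917869, 344752362,
      -12170104, -22007602, -2909828, 775061, 241435, -8647, -12526, -1130, 456, 111, -8, -6],
    cx := [425903038165, -331727246157, -19217697929, 13194943987, 1275183983, -192506045,
      -91687829, -6081705, 4365408, 894841, -114265, -57632, -1575, 2537, 393, -72, -28, 0, 1],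
    sy := [571664773607, 281352100517, -9330628080, -18077264890, 112041497, 723036291,
      41502080, -31046057, -4287754, 1003579, 274561, -14535, -13730, -911, 531, 103, -13, -6],
    cy := [820487286076, -196028735090, -65155358579, 227919222, 3535172758, 114951055,
      -166557373, -13556653, 5914768, 1121258, -141528, -64083, -673, 2816, 352, -91, -27, 1, 1],
    sw := [253280927417, 209596947514, 45633111014, -5705968966, -3139619726, -126272108,
      106941024, 21909653, -2030437, -1322329, -57165, 58661, 9248, -1873, -646, 22, 33, 3, -1],
    cw := [967392770187, -54876272478, -36209842168, -10447058464, -288303683, 575061950,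
      96050967, -17608460, -6335832, 163740, 304986, 25155, -11453, -2447, 270, 147, 3, -7, -1] },
  { px := [1772061153227, 244711326427, -53508269263, -7065538575, 894054717, 246502571,
      -27523612, -6612830, 1249848, 127873, -57594, 65, 2396, -194, -86, 15, 2, -1],
    py := [1349687106330, 371350960856, -9270360885, -2354943866, 1395718009, -4636085,
      -46481392, 755443, 1533773, -97475, -53510, 7640, 1815, -449, -53, 23, 1, -1],
    pw := [868890555624, 369774418787, 15433256881, -8755592712, 91951147, 153924254, -35384693,
      -2346250, 1624755, -30255, -57372, 6145, 1777, -406, -44, 21, 0, -1],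
    sx := [979814511741, -48919944104, -18640653321, 14730483059, -61161866, -735850669,
      13952724, 32375045, -2314709, -1411872, 221730, 57461, -15417, -1944, 900, 38, -47, 1, 2],
    cx := [-199908785667, -239771708820, 58413810927, 6698362535, -2535135660, 32713598,
      129087962, -10840983, -6887936, 885006, 311985, -60586, -11572, 3717, 312, -206, -1, 10,
      -1],
    sy := [975654784252, 81441712286, -69305247886, 970457359, 2030656085, -560177937,
      -43334288, 34295512, -718447, -1513771, 178351, 56273, -13929, -1612, 818, 14, -41, 3, 2],
    cy := [219311974034, -362310341598, -6077057106, 11379798423, -1629233355, -331557116,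
      152239583, 4368813, -7567705, 473860, 302516, -51812, -10154, 3433, 220, -186, 4, 9, -1],
    sw := [763613067593, 238753776390, -42240744184, -15451989607, 2354289001, 671173343,
      -113926687, -19180066, 6349082, 284117, -340733, 15668, 15751, -2090, -601, 154, 16, -9],
    cw := [645674130658, -282364578247, -55927556079, 9435901644, 3252001768, -435728529,
      -122136295, 26381919, 3036543, -1519634, 1874, 75872, -6668, -3180, 595, 105, -38, -2, 2] },
  { px := [2010845374975, -12702249002, -63493030537, 4064943501, 1190214407, -143705233,
      -13259759, 3875737, -37910, -11919, 4318, -2581, 84, 80, -9],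
    py := [2056080225696, 342894126332, 1025379041, 3407729073, -233219863, -173289110,
      18801860, 2615303, -479184, 17865, 82, -1479, 547, -4, -23, 2],
    pw := [1604317659387, 335242767566, -30309912050, -6629863770, 116897900, -29382789,
      14508069, 2763313, -569879, -22234, 4986, -1000, 359, 11, -16, 1],
    sx := [904730770577, 5410952819, 26974017167, -2461414995, -2286128250, 297653758, 48303594,
      -10114662, 424227, 2164, -42934, 17324, -129, -835, 91, 14, -4],
    cx := [-425983840980, 11492115527, 57478464079, -3334430710, -244805339, -9247196,
      -51510248, 10467910, 1720564, -639640, 1575, 17338, -1805, 52, 31, -22, 3, 1],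
    sy := [884542557418, -159946222343, -52478954551, 1233746734, -387634416, 229678416,
      51037261, -12029064, -527984, 131560, -29032, 11371, 384, -596, 52, 8, -2],
    cy := [-466459498898, -303304447430, 26515318686, 3093297371, 536227221, 256817409,
      -62983460, -8068209, 1827322, -41274, 17052, 5178, -3009, 109, 89, -13],
    sw := [999438212741, -11235679817, -55146449238, 10588129356, 2227272120, -437752985,
      -23990024, 6537526, -836471, 217813, 13221, -15660, 1383, 294, -60, 8, 0, -1],
    cw := [-33515055071, -335054432450, 32176224526, 12561586973, -1895840958, -209916310,
      71583293, -800210, -283044, 113920, -74898, 2670, 2740, -328, -6, 6, -3] },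
  { px := [1778064817485, -192182093573, -22743153002, 7738826562, -67950633, -34058594,
      20763043, -936412, -631285, 5190, 14697, 635, -372, -18, 9],
    py := [2765378594938, 370889399377, 7494503452, -1691794077, -579235207, 89862439, 13418419,
      -2126901, 3853, 33991, -5793, -1148, 213, 49, -8, -1],
    pw := [2102584107447, 139245811744, -65368291103, -4073009012, 801656898, 115825080,
      -8180457, -4137458, 149602, 102965, -1190, -2041, -21, 44, -1, -1],
    sx := [978596675561, 39548696593, -13391464372, -6113279584, 1185516278, 212428070,
      -39282992, 81323, 807169, -152838, -33322, 6747, 1696, -285, -56, 11, 1],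
    cx := [-205787624950, 188068757873, 26056649575, -7831415127, -609046893, 87612945,
      19643603, -3980691, -69020, 239809, -37011, -9123, 1848, 280, -56, -8, 2],
    sy := [367401949710, -344950232969, -32240067402, 8460730093, 1528030166, -129505474,
      -76417173, 3157825, 2445065, -31391, -59223, -652, 1503, -46, -39, 6, 1],
    cy := [-930062259930, -136265488459, 61215697180, 6330888662, -888563554, -364297251,
      19797048, 15052828, -436952, -399065, 290, 9449, -30, -242, 21, 6, -1],
    sw := [861901909438, -70608075879, 24790750220, 10138751802, -2066977527, -279163178,
      44181397, 1980179, -700564, 45769, 34656, -3344, -1991, 158, 83, -4, -3],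
    cw := [-507075042289, -120016231023, 61256994339, -717154641, -449320301, 328701417,
      -17295143, -13325226, 123250, 387770, 18443, -11773, -605, 332, 2, -9, 1] }]

theorem upper_phaseOk : phaseOk 77000000000000 [14700900000, 14700900000]
    [14700370487, 14699311475, -1588496, -529461, 29, 6]
    [999891943715, -216108677, -108046554, 7784, 1946, 0] = true := by
  decide +kernel

theorem upper_chainOk : chainOk 379001286883 77000000000000 50000000000000
    [0, 29401800000, 0, 0, 1000000000000, 29397564040, 999567798214, 0, 1000000000000]
    upperPieces
    [1570795603732, 3141592653596, 2173294032496, 1000000000000,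
      723056, 0, -1000000000000, 823922731212, -566702155456] = true := by
  decide +kernel

theorem exp_four_le : Real.exp 4 ≤ 55 := by
  have h : Real.exp 4 = Real.exp 1 ^ 4 := by rw [← Real.exp_nat_mul]; norm_num
  rw [h]
  have h1 := Real.exp_one_lt_d9
  calc Real.exp 1 ^ 4 ≤ 2.7182818286 ^ 4 := by gcongr
    _ ≤ 55 := by norm_num

/-- The orbit from `(0, y₀, 0)` is close to its piecewise polynomial approximation. -/
theorem IsShiftedOrbit.dist_le_of_chainOk {f : ℝ → ℝ × ℝ × ℝ} (hf : IsShiftedOrbit f) {H : ℤ}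
    (hH : 0 < H) {δ ε : ℕ} {p s c : List ℤ} (h : phaseOk δ p s c = true)
    (hp : evalInt (-1) p = 0) (hs : evalInt (-1) s = 0) (hc : evalInt (-1) c = scale)
    {L : List Piece} {x y w sx cx sy cy sw cw : ℤ}
    (hL : chainOk H δ ε
      [0, evalInt 1 p, 0, 0, scale, evalInt 1 s, evalInt 1 c, 0, scale] L
      [x, y, w, sx, cx, sy, cy, sw, cw] = true)
    (h0 : f 0 = (0, (evalInt 1 p : ℝ) / scale, 0)) {η T : ℝ}
    (hη : (L.length + 1) * (4 * (δ / scale ^ 2)) + ε / (scale * H) ≤ η)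
    (hT : L.length * (2 * (H / scale)) = T) (hT4 : T ≤ 4) :
    dist ((x / scale, y / scale, w / scale) : ℝ × ℝ × ℝ) (f T) ≤ 54 * η := by
  have hS := scale_pos
  have hH' : (0 : ℝ) < H := by exact_mod_cast hH
  have e1 : ∀ l, ((evalInt 1 l : ℤ) : ℝ) = eval 1 l := fun l => by
    rw [← eval_intCast]; norm_num
  have hz : phaseDist 0 0 1 = 0 := by simp [phaseDist]
  have hd : (0 : ℝ) ≤ 4 * (δ / scale ^ 2) := by positivity
  have hn : Near f η 0 (4 * (δ / scale ^ 2))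
      [0, evalInt 1 p, 0, 0, scale, evalInt 1 s, evalInt 1 c, 0, scale] := by
    have h1 := phaseDist_le_of_phaseOk h (θ := 1) (by constructor <;> norm_num)
    rw [hp, hs, hc] at h1
    simp only [Near, h0, Int.cast_zero, zero_div, div_self hS.ne', hz, dist_self, Real.exp_zero,
      sub_self, mul_zero, le_refl, true_and, hd, and_true]
    simpa [hz, hS.ne', e1] using h1
  have hfin := (Near.chain hf hH L hL hn (by linarith)).1
  rw [zero_add, hT] at hfin
  have hη0 : 0 ≤ η := le_trans (by positivity) hη
  have hexp : Real.exp T ≤ 55 := (Real.exp_le_exp.mpr hT4).trans exp_four_le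
  calc _ ≤ η * (Real.exp T - 1) := hfin
    _ ≤ η * 54 := by gcongr; linarith
    _ = 54 * η := mul_comm _ _

theorem lower_dist_le {f : ℝ → ℝ × ℝ × ℝ} (hf : IsShiftedOrbit f) (h0 : f 0 = (0, 0.0294007, 0)) :
    dist ((1.570797042752, 3.141592653596, 2.173294269446) : ℝ × ℝ × ℝ) (f 3.79001498713)
      ≤ 2e-7 := by
  have h := hf.dist_le_of_chainOk (by norm_num) lower_phaseOk (by decide) (by decide) (by decide)
    lower_chainOk (η := 2e-9) (T := 3.79001498713)
    (h0.trans (by simp [evalInt, scale]; norm_num))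
    (by simp [lowerPieces, scale]; norm_num) (by simp [lowerPieces, scale]; norm_num)
    (by norm_num)
  norm_num [scale] at h ⊢
  linarith

theorem upper_dist_le {f : ℝ → ℝ × ℝ × ℝ} (hf : IsShiftedOrbit f) (h0 : f 0 = (0, 0.0294018, 0)) :
    dist ((1.570795603732, 3.141592653596, 2.173294032496) : ℝ × ℝ × ℝ) (f 3.79001286883)
      ≤ 2e-7 := by
  have h := hf.dist_le_of_chainOk (by norm_num) upper_phaseOk (by decide) (by decide) (by decide)
    upper_chainOk (η := 2e-9) (T := 3.79001286883)
    (h0.trans (by simp [evalInt, scale]; norm_num))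
    (by simp [upperPieces, scale]; norm_num) (by simp [upperPieces, scale]; norm_num)
    (by norm_num)
  norm_num [scale] at h ⊢
  linarith

theorem abs_le_of_dist_le {p q : ℝ × ℝ × ℝ} {r : ℝ} (h : dist p q ≤ r) :
    |p.1 - q.1| ≤ r ∧ |p.2.1 - q.2.1| ≤ r ∧ |p.2.2 - q.2.2| ≤ r := by
  simpa [Prod.dist_eq, Real.dist_eq] using h

/-- The time interval that contains the quarter period. -/
def quarterTimes : Set ℝ := Icc 3.78991498713 3.79011498713

theorem dist_orbits_le {f g : ℝ → ℝ × ℝ × ℝ} (hf : IsShiftedOrbit f) (hg : IsShiftedOrbit g)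
    {a a' : ℝ} (hf0 : f 0 = (0, a, 0)) (hg0 : g 0 = (0, a', 0)) {t : ℝ} (ht : t ∈ quarterTimes) :
    dist (f t) (g t) ≤ 55 * |a - a'| := by
  have ht' := ht.1
  have ht'' := ht.2
  have h := hf.dist_le hg (t := t) (by norm_num at ht' ⊢; linarith)
  have hd : dist (f 0) (g 0) = |a - a'| := by
    simp [hf0, hg0, Prod.dist_eq, Real.dist_eq]
  have he : Real.exp t ≤ 55 :=
    (Real.exp_le_exp.mpr (by norm_num at ht'' ⊢; linarith)).trans exp_four_le
  rw [hd] at h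
  calc _ ≤ _ := h
    _ ≤ |a - a'| * 55 := by gcongr
    _ = _ := mul_comm _ _

/-- The position at the quarter period, up to an error that covers all orbits considered. -/
theorem dist_quarter_le {f : ℝ → ℝ × ℝ × ℝ} (hf : IsShiftedOrbit f) {a : ℝ}
    (ha : a ∈ Icc (0.0294007 : ℝ) 0.0294018) (h0 : f 0 = (0, a, 0)) :
    dist ((1.570797042752, 3.141592653596, 2.173294269446) : ℝ × ℝ × ℝ) (f 3.79001498713)
      ≤ 6.1e-5 := by
  obtain ⟨g, hg0, hg⟩ := exists_isShiftedOrbit (0, 0.0294007, 0)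
  have h1 := lower_dist_le hg hg0
  have h2 := dist_orbits_le hg hf hg0 h0 (t := 3.79001498713)
    (by constructor <;> norm_num)
  have h3 : |0.0294007 - a| ≤ (1.1e-6 : ℝ) := by
    rw [abs_le]
    have := ha.1
    have := ha.2
    constructor <;> norm_num at * <;> linarith
  have h4 := dist_triangle ((1.570797042752, 3.141592653596, 2.173294269446) : ℝ × ℝ × ℝ)
    (g 3.79001498713) (f 3.79001498713)
  norm_num at *
  linarith

theorem dist_quarterTimes_le {f : ℝ → ℝ × ℝ × ℝ} (hf : IsShiftedOrbit f) {a : ℝ}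
    (ha : a ∈ Icc (0.0294007 : ℝ) 0.0294018) (h0 : f 0 = (0, a, 0)) {t : ℝ}
    (ht : t ∈ quarterTimes) :
    dist ((1.570797042752, 3.141592653596, 2.173294269446) : ℝ × ℝ × ℝ) (f t) ≤ 2e-4 := by
  have h1 := dist_quarter_le hf ha h0
  have h2 := hf.dist_time_le 3.79001498713 t
  have h3 : |3.79001498713 - t| ≤ (1e-4 : ℝ) := by
    rw [abs_le]
    have := ht.1
    have := ht.2
    constructor <;> norm_num at * <;> linarith
  have h4 := dist_triangle ((1.570797042752, 3.141592653596, 2.173294269446) : ℝ × ℝ × ℝ)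
    (f 3.79001498713) (f t)
  norm_num at *
  linarith

theorem le_sin_x {f : ℝ → ℝ × ℝ × ℝ} (hf : IsShiftedOrbit f) {a : ℝ}
    (ha : a ∈ Icc (0.0294007 : ℝ) 0.0294018) (h0 : f 0 = (0, a, 0)) {t : ℝ}
    (ht : t ∈ quarterTimes) : 0.9 ≤ Real.sin (f t).1 := by
  have h1 := (abs_le_of_dist_le (dist_quarterTimes_le hf ha h0 ht)).1
  have hpi := Real.pi_gt_d6
  have hpi' := Real.pi_lt_d6
  have h2 : |Real.pi / 2 - (f t).1| ≤ 0.01 := by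
    rw [abs_le] at h1 ⊢
    constructor <;> norm_num at * <;> linarith
  rw [← Real.cos_pi_div_two_sub]
  refine le_trans ?_ (Real.one_sub_sq_div_two_le_cos)
  rw [← sq_abs]
  have := pow_le_pow_left₀ (abs_nonneg _) h2 2
  norm_num at *
  linarith

/-- In the time interval considered, `y` grows at a speed of at least `0.9`. -/
theorem mul_sub_le_y_sub {f : ℝ → ℝ × ℝ × ℝ} (hf : IsShiftedOrbit f) {a : ℝ}
    (ha : a ∈ Icc (0.0294007 : ℝ) 0.0294018) (h0 : f 0 = (0, a, 0)) {s t : ℝ}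
    (hs : s ∈ quarterTimes) (ht : t ∈ quarterTimes) (hst : s ≤ t) :
    0.9 * (t - s) ≤ (f t).2.1 - (f s).2.1 := by
  refine Convex.mul_sub_le_image_sub_of_le_deriv (convex_Icc (3.78991498713 : ℝ) 3.79011498713)
    (f := fun t => (f t).2.1) (C := 0.9) hf.continuous.snd.fst.continuousOn
    (fun t _ => (hf.hasDerivAt_y t).differentiableAt.differentiableWithinAt) (fun t h => ?_)
    s hs t ht hst
  rw [(hf.hasDerivAt_y t).deriv]
  exact le_sin_x hf ha h0 (interior_subset h)

theorem abs_sub_le_y {f : ℝ → ℝ × ℝ × ℝ} (hf : IsShiftedOrbit f) {a : ℝ}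
    (ha : a ∈ Icc (0.0294007 : ℝ) 0.0294018) (h0 : f 0 = (0, a, 0)) {s t : ℝ}
    (hs : s ∈ quarterTimes) (ht : t ∈ quarterTimes) :
    0.9 * |t - s| ≤ |(f t).2.1 - (f s).2.1| := by
  rcases le_total s t with h | h
  · rw [abs_of_nonneg (sub_nonneg.mpr h)]
    exact (mul_sub_le_y_sub hf ha h0 hs ht h).trans (le_abs_self _)
  · rw [abs_sub_comm, abs_sub_comm (f t).2.1, abs_of_nonneg (sub_nonneg.mpr h)]
    exact (mul_sub_le_y_sub hf ha h0 ht hs h).trans (le_abs_self _)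

theorem exists_y_eq_pi {f : ℝ → ℝ × ℝ × ℝ} (hf : IsShiftedOrbit f) {a : ℝ}
    (ha : a ∈ Icc (0.0294007 : ℝ) 0.0294018) (h0 : f 0 = (0, a, 0)) :
    ∃ t ∈ quarterTimes, (f t).2.1 = Real.pi := by
  have hle : (3.78991498713 : ℝ) ≤ 3.79011498713 := by norm_num
  have hm : (3.79001498713 : ℝ) ∈ quarterTimes := by constructor <;> norm_num
  have h1 := (abs_le.mp (abs_le_of_dist_le (dist_quarter_le hf ha h0)).2.1)
  have hl := mul_sub_le_y_sub hf ha h0 (left_mem_Icc.mpr hle) hm (by norm_num)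
  have hr := mul_sub_le_y_sub hf ha h0 hm (right_mem_Icc.mpr hle) (by norm_num)
  have hpi := Real.pi_gt_d20
  have hpi' := Real.pi_lt_d20
  refine intermediate_value_Icc hle (f := fun t => (f t).2.1)
    hf.continuous.snd.fst.continuousOn ⟨?_, ?_⟩
  · norm_num at *
    linarith
  · norm_num at *
    linarith

/-- There is an orbit that starts on the axis `x = w = 0` and reaches the line
`x = π / 2`, `y = π`. -/
theorem exists_orbit_to_line : ∃ a ∈ Icc (0.0294007 : ℝ) 0.0294018, ∃ T ∈ quarterTimes,
    ∃ f, IsShiftedOrbit f ∧ f 0 = (0, a, 0) ∧ (f T).1 = Real.pi / 2 ∧ (f T).2.1 = Real.pi := by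
  choose φ hφ0 hφ using fun a : ℝ => exists_isShiftedOrbit (0, a, 0)
  have hex := fun a (ha : a ∈ Icc (0.0294007 : ℝ) 0.0294018) =>
    exists_y_eq_pi (hφ a) ha (hφ0 a)
  choose! T hT hy using hex
  have hle : (0.0294007 : ℝ) ≤ 0.0294018 := by norm_num
  have hpi := Real.pi_gt_d20
  have hpi' := Real.pi_lt_d20
  have time_lip : ∀ a ∈ Icc (0.0294007 : ℝ) 0.0294018, ∀ a' ∈ Icc (0.0294007 : ℝ) 0.0294018,
      0.9 * |T a - T a'| ≤ 55 * |a - a'| := by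
    intro a ha a' ha'
    refine (abs_sub_le_y (hφ a) ha (hφ0 a) (hT a' ha') (hT a ha)).trans ?_
    rw [hy a ha, ← hy a' ha', abs_sub_comm a]
    exact (abs_le_of_dist_le
      (dist_orbits_le (hφ a') (hφ a) (hφ0 a') (hφ0 a) (hT a' ha'))).2.1
  have lip : LipschitzOnWith 117 (fun a => (φ a (T a)).1) (Icc 0.0294007 0.0294018) := by
    refine LipschitzOnWith.of_dist_le_mul fun a ha a' ha' => ?_
    have h1 := (abs_le_of_dist_le ((hφ a).dist_time_le (T a) (T a'))).1
    have h2 := (abs_le_of_dist_le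
      (dist_orbits_le (hφ a) (hφ a') (hφ0 a) (hφ0 a') (hT a' ha'))).1
    have h3 := time_lip a ha a' ha'
    have h4 := abs_sub_le (φ a (T a)).1 (φ a (T a')).1 (φ a' (T a')).1
    rw [Real.dist_eq, Real.dist_eq]
    norm_num at *
    linarith [abs_nonneg (a - a')]
  have near : ∀ a ∈ Icc (0.0294007 : ℝ) 0.0294018, ∀ t ∈ quarterTimes, ∀ x w : ℝ,
      dist ((x, 3.141592653596, w) : ℝ × ℝ × ℝ) (φ a t) ≤ 2e-7 →
      |x - (φ a (T a)).1| ≤ 5e-7 := by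
    intro a ha t ht x w h
    have h1 := abs_sub_le_y (hφ a) ha (hφ0 a) (hT a ha) ht
    rw [hy a ha] at h1
    have h2 := abs_le_of_dist_le h
    have h3 := (abs_le_of_dist_le ((hφ a).dist_time_le t (T a))).1
    have h4 := abs_sub_le x (φ a t).1 (φ a (T a)).1
    have h5 : |(φ a t).2.1 - Real.pi| ≤ 2.1e-7 := by
      have := abs_le.mp h2.2.1
      rw [abs_le]
      constructor <;> norm_num at * <;> linarith
    have h6 := h2.1
    norm_num at *
    linarith
  have hlo := near _ (left_mem_Icc.mpr hle) 3.79001498713 (by constructor <;> norm_num) _ _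
    (lower_dist_le (hφ _) (hφ0 _))
  have hup := near _ (right_mem_Icc.mpr hle) 3.79001286883 (by constructor <;> norm_num) _ _
    (upper_dist_le (hφ _) (hφ0 _))
  obtain ⟨a, ha, hx⟩ := intermediate_value_Icc' hle lip.continuousOn
    (show Real.pi / 2 ∈ Icc _ _ from
      ⟨by have := (abs_le.mp hup).1; norm_num at *; linarith,
        by have := (abs_le.mp hlo).2; norm_num at *; linarith⟩)
  exact ⟨a, ha, T a, hT a ha, φ a, hφ a, hφ0 a, hx, hy a ha⟩

/-- A continuous function that grows by `c` over each period `τ` has average speed `c / τ`. -/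
theorem tendsto_div_of_add_period {u : ℝ → ℝ} (hu : Continuous u) {τ c : ℝ} (hτ : 0 < τ)
    (h : ∀ t, u (t + τ) = u t + c) : Tendsto (fun t => u t / t) atTop (𝓝 (c / τ)) := by
  set v : ℝ → ℝ := fun t => u t - c / τ * t
  have hv : Continuous v := by fun_prop
  have hper : Function.Periodic v τ := fun t => by
    simp only [v, h]
    field_simp
    ring
  obtain ⟨C, hC⟩ : ∃ C, ∀ t, ‖v t‖ ≤ C := by
    obtain ⟨C, hC⟩ := (isCompact_Icc (a := 0) (b := τ)).exists_bound_of_continuousOn hv.continuousOn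
    refine ⟨C, fun t => ?_⟩
    obtain ⟨s, hs, hst⟩ := hper.exists_mem_Ico₀ hτ t
    rw [hst]
    exact hC s (Ico_subset_Icc_self hs)
  have h0 : Tendsto (fun t => v t / t) atTop (𝓝 0) := by
    refine squeeze_zero_norm' (a := fun t => C / t) ?_ (tendsto_const_nhds.div_atTop tendsto_id)
    filter_upwards [eventually_gt_atTop 0] with t ht
    rw [norm_div, Real.norm_of_nonneg ht.le]
    gcongr
    exact hC t
  have h1 := h0.add_const (c / τ)
  rw [zero_add] at h1
  refine h1.congr' ?_
  filter_upwards [eventually_gt_atTop 0] with t ht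
  simp only [v]
  field_simp
  ring

theorem IsOrbit.isBallisticOrbit {X : ℝ → Space3} {e : Space3} {τ : ℝ}
    (hX : IsOrbit kolmogorovFlow X) (he : inner ℝ e e = (1 : ℝ)) (hτ : 0 < τ) (h : ∀ t, X (t + τ) = X t + (2 * Real.pi) • e) :
    IsBallisticOrbit kolmogorovFlow e τ X where
  orbit := hX
  period_pos := hτ
  periodic := h
  speed := by
    have hc : Continuous X := continuous_iff_continuousAt.mpr fun t => (hX t).continuousAt
    refine tendsto_div_of_add_period (hc.inner continuous_const) hτ fun t => ?_
    rw [h, inner_add_left, inner_smul_left, he]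
    simp

theorem IsOrbit.neg {X : ℝ → Space3} (hX : IsOrbit kolmogorovFlow X) :
    IsOrbit kolmogorovFlow fun t => -X t := by
  intro t
  refine (hX t).neg.congr_deriv ?_
  ext i
  fin_cases i <;> simp [kolmogorovFlow]

theorem inner_e₁_self : inner ℝ e₁ e₁ = (1 : ℝ) := by
  rw [real_inner_self_eq_norm_sq]
  simp [e₁, EuclideanSpace.norm_eq, Fin.sum_univ_three]

theorem proposition2 :
    ∃ a b τ : ℝ,
      (0.029 < a ∧ a < 0.030) ∧ (0.602 < b ∧ b < 0.603) ∧ |τ - 15.160| < 0.0005 ∧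
      ∃ X Y : ℝ → Space3,
        IsOrbit kolmogorovFlow X ∧
        X 0 = !₂[0, a, Real.pi / 2] ∧
        X (τ / 4) = !₂[Real.pi / 2, Real.pi, Real.pi + b] ∧
        IsBallisticOrbit kolmogorovFlow e₁ τ X ∧
        IsOrbit kolmogorovFlow Y ∧
        Y 0 = !₂[0, -a, -(Real.pi / 2)] ∧
        (∀ t : ℝ, Y t = -X t) ∧
        IsBallisticOrbit kolmogorovFlow (-e₁) τ Y := by
  obtain ⟨a, ha, T, hT, f, hf, hf0, hx, hy⟩ := exists_orbit_to_line
  have hw := (abs_le.mp (abs_le_of_dist_le (dist_quarterTimes_le hf ha hf0 hT)).2.2)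
  have ha' := ha
  have hT' := hT
  simp only [quarterTimes, mem_Icc] at ha' hT'
  have hpi := Real.pi_gt_d6
  have hpi' := Real.pi_lt_d6
  have hper : ∀ t, (!₂[(f (t + 4 * T)).1, (f (t + 4 * T)).2.1, (f (t + 4 * T)).2.2 + Real.pi / 2]
      : Space3) = !₂[(f t).1, (f t).2.1, (f t).2.2 + Real.pi / 2] + (2 * Real.pi) • e₁ := by
    intro t
    rw [hf.periodic (by rw [hf0]) (by rw [hf0]) hx hy]
    ext i
    fin_cases i <;> simp [e₁]
  have hτ : 0 < 4 * T := by norm_num at *; linarith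
  have hbal := hf.isOrbit.isBallisticOrbit inner_e₁_self hτ hper
  refine ⟨a, (f T).2.2 - Real.pi / 2, 4 * T, ?_, ?_, ?_, _, _, hf.isOrbit, ?_, ?_, hbal,
    hf.isOrbit.neg, ?_, fun t => rfl, hf.isOrbit.neg.isBallisticOrbit ?_ hτ fun t => ?_⟩
  · constructor <;> norm_num at * <;> linarith
  · constructor <;> norm_num at * <;> linarith
  · rw [abs_lt]
    constructor <;> norm_num at * <;> linarith
  · simp [hf0]
  · rw [mul_div_cancel_left₀ T (by norm_num : (4 : ℝ) ≠ 0), hx, hy]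
    congr 4
    ring_nf
  · simp only [hf0]
    ext i
    fin_cases i <;> simp
  · rw [inner_neg_neg, inner_e₁_self]
  · simp only [hper, smul_neg]
    abel
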